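/- Let $\mathrm e=(e_s)_{0\le s\le 1}$ be a random continuous function such that $\frac12\mathrm e$ is a standard normalised Brownian excursion of duration $1$. For $s,t\in[0,1]$ put $b(s,t)=\min_{s\wedge t\le u\le s\vee t}e_u$ and $d(s,t)=e_s+e_t-2b(s,t)$, let $\mathcal T=[0,1]/\!\!\sim$ with $s\sim t\iff d(s,t)=0$, equipped with the metric induced by $d$ (the Brownian continuum random tree), let $p:[0,1]\to\mathcal T$ be the canonical projection, $\rho=p(0)$ the root, $\llbracket\sigma,\sigma'\rrbracket$ the geodesic segment between $\sigma,\sigma'\in\mathcal T$, $\mu$ the image under $p$ of the uniform measure on $[0,1]$, and $\ell$ the length measure on $\mathcal T$ (the one-dimensional Hausdorff measure on the skeleton, so that $\ell(\llbracket\sigma,\sigma'\rrbracket)=d(\sigma,\sigma')$). Conditionally on $\mathrm e$, let $\mathcal P=\sum_{i\ge1}\delta_{(t_i,x_i)}$ be a Poisson point measure on $\mathbb R_+\times\mathcal T$ with intensity $dt\,\ell(dx)$. For real $k\ge 1$ put $\tilde{\mathcal P}=\sum_{i\ge1}\delta_{((\Gamma(k+1)t_i)^{1/k},\,x_i)}$,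 $\tilde{\mathcal T}_t=\{\sigma\in\mathcal T:\tilde{\mathcal P}([0,t]\times\llbracket\rho,\sigma\rrbracket)=0\}$ and $$X_k(\mathcal T)=\int_0^\infty\mu(\tilde{\mathcal T}_t)\,dt .$$ For $\mathbf s=(s_1,\dots,s_q)\in[0,1]^q$ let $\Delta^{\mathrm e}_1(\mathbf s)=e_{s_1}$ and $\Delta^{\mathrm e}_r(\mathbf s)=e_{s_r}-\max_{i<r}b(s_i,s_r)$ for $2\le r\le q$. Then, for every real $k\ge 1$ and every $q\in\mathbb N$, $X_k(\mathcal T)$ is a $[0,\infty]$-valued random variable and, almost surely (as an identity between $[0,\infty]$-valued random variables), $$\mathbb E\big[X_k(\mathcal T)^q\,\big|\,\mathrm e\big]=q!\int_{[0,1]^q}\int_{0<x_q<\dots<x_1}\exp\Big(-\frac1{\Gamma(k+1)}\sum_{r=1}^q\Delta^{\mathrm e}_r(\mathbf s)\,x_r^k\Big)\,dx\,d\mathbf s ,$$ where $\Gamma(k+1)=k!$ when $k$ is an integer. -/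

import Mathlib

open MeasureTheory ProbabilityTheory Set Filter Topology
open scoped ENNReal NNReal unitInterval Nat

noncomputable section

/-! ### The real tree coded by a continuous function -/

namespace CRT

/-- `b w s t` is the minimum of `w` on the interval with endpoints `s` and `t`. -/
def b (w : C(I, ℝ)) (s t : I) : ℝ := sInf (w '' uIcc s t)

lemma isCompact_image_uIcc (w : C(I, ℝ)) (s t : I) : IsCompact (w '' uIcc s t) :=
  isCompact_uIcc.image w.continuous

lemma b_le (w : C(I, ℝ)) {s t u : I} (hu : u ∈ uIcc s t) : b w s t ≤ w u :=
  csInf_le (isCompact_image_uIcc w s t).bddBelow ⟨u, hu, rfl⟩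

/-- The minimum is attained. -/
lemma exists_b_eq (w : C(I, ℝ)) (s t : I) : ∃ u ∈ uIcc s t, w u = b w s t :=
  (isCompact_image_uIcc w s t).sInf_mem ((nonempty_uIcc).image w)

lemma b_comm (w : C(I, ℝ)) (s t : I) : b w s t = b w t s := by
  simp only [b, uIcc_comm]

lemma b_self (w : C(I, ℝ)) (s : I) : b w s s = w s := by simp [b]

lemma min_b_le (w : C(I, ℝ)) (s t u : I) : min (b w s t) (b w t u) ≤ b w s u := by
  obtain ⟨v, hv, hvb⟩ := exists_b_eq w s u
  rw [← hvb]
  rcases uIcc_subset_uIcc_union_uIcc (a := s) (b := t) (c := u) hv with h | h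
  · exact (min_le_left _ _).trans (b_le w h)
  · exact (min_le_right _ _).trans (b_le w h)

/-- The interval `[0, 1]` carrying the pseudo-distance `d(s, t) = w s + w t - 2 b(s, t)`. -/
def PreTree (_w : C(I, ℝ)) : Type := I

lemma dist_triangle_aux (w : C(I, ℝ)) (s t u : I) :
    w s + w u - 2 * b w s u ≤ (w s + w t - 2 * b w s t) + (w t + w u - 2 * b w t u) := by
  have h1 := min_b_le w s t u
  have h2 : b w s t ≤ w t := b_le w right_mem_uIcc
  have h3 : b w t u ≤ w t := b_le w left_mem_uIcc
  rcases min_le_iff.1 h1 with h | h <;> linarith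

instance (w : C(I, ℝ)) : PseudoMetricSpace (PreTree w) where
  dist := fun (s t : I) => w s + w t - 2 * b w s t
  dist_self := fun (s : I) =>
    show w s + w s - 2 * b w s s = 0 by rw [b_self]; ring
  dist_comm := fun (s t : I) =>
    show w s + w t - 2 * b w s t = w t + w s - 2 * b w t s by rw [b_comm]; ring
  dist_triangle := dist_triangle_aux w

/-- The tree coded by `w`: the quotient of `[0, 1]` by `s ∼ t ↔ d(s, t) = 0`, with the metric
induced by `d`. -/
abbrev Tree (w : C(I, ℝ)) : Type := SeparationQuotient (PreTree w)

instance (w : C(I, ℝ)) : MeasurableSpace (Tree w) := borel _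

instance (w : C(I, ℝ)) : BorelSpace (Tree w) := ⟨rfl⟩

/-- The canonical projection `[0, 1] → Tree w`. -/
def proj (w : C(I, ℝ)) (s : I) : Tree w := SeparationQuotient.mk (X := PreTree w) s

lemma dist_proj (w : C(I, ℝ)) (s t : I) :
    dist (proj w s) (proj w t) = w s + w t - 2 * b w s t := rfl

lemma continuous_proj (w : C(I, ℝ)) : Continuous (proj w) := by
  rw [continuous_iff_continuousAt]
  intro s
  rw [ContinuousAt, Metric.tendsto_nhds]
  intro ε hε
  obtain ⟨δ, hδ, hw⟩ := Metric.continuousAt_iff.1 (w.continuous.continuousAt (x := s)) (ε / 4)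
    (by positivity)
  filter_upwards [Metric.ball_mem_nhds s hδ] with t ht
  obtain ⟨u, hu, hub⟩ := exists_b_eq w t s
  have hus : dist u s < δ := by
    refine lt_of_le_of_lt ?_ (Metric.mem_ball.1 ht)
    rw [uIcc_comm] at hu
    have := abs_sub_left_of_mem_uIcc (a := (s : ℝ)) (b := t) (c := u) (by
      rcases mem_uIcc.1 hu with h | h
      · exact mem_uIcc.2 (Or.inl h)
      · exact mem_uIcc.2 (Or.inr h))
    simpa [Subtype.dist_eq, Real.dist_eq] using this
  have h1 := hw (Metric.mem_ball.1 ht)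
  have h2 := hw hus
  rw [Real.dist_eq, abs_lt] at h1 h2
  rw [dist_proj, ← hub]
  linarith [h1.1, h1.2, h2.1, h2.2]

lemma measurable_proj (w : C(I, ℝ)) : Measurable (proj w) := (continuous_proj w).measurable

/-- The root of the tree. -/
def root (w : C(I, ℝ)) : Tree w := proj w 0

/-- The geodesic segment `⟦x, y⟧` between two points (in an `ℝ`-tree, this is the unique path
joining them). -/
def segment {X : Type*} [MetricSpace X] (x y : X) : Set X :=
  {z | dist x z + dist z y = dist x y}

/-- The skeleton: all points in the interior of some geodesic segment. -/
def skeleton (X : Type*) [MetricSpace X] : Set X :=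
  {z | ∃ x y : X, z ∈ segment x y ∧ z ≠ x ∧ z ≠ y}

/-- The mass measure: the image of the uniform measure on `[0, 1]` under the projection. -/
def massMeasure (w : C(I, ℝ)) : Measure (Tree w) := (volume : Measure I).map (proj w)

/-- The length measure: the one-dimensional Hausdorff measure carried by the skeleton. It is the
`σ`-finite measure giving each segment `⟦x, y⟧` mass `dist x y` (and no mass to the leaves). -/
def lengthMeasure (w : C(I, ℝ)) : Measure (Tree w) := (μH[1]).restrict (skeleton (Tree w))

/-! ### Cutting the tree -/

/-- The point measure `∑ i, δ_(t i, x i)` of cuts (time and location), where `x i` is the point of the tree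
represented by `u i ∈ [0, 1]` and `y i = (t i, u i)`. Times live in `ℝ`; the intensity used below
vanishes on negative times. -/
def cutMeasure (w : C(I, ℝ)) (y : ℕ → ℝ × I) : Measure (ℝ × Tree w) :=
  Measure.sum fun i => Measure.dirac ((y i).1, proj w (y i).2)

/-- The time-changed point measure `∑ i, δ_(s i, x i)` with `s i = (Γ(k + 1) * t i) ^ (1 / k)`. -/
def cutMeasureTilde (k : ℝ) (w : C(I, ℝ)) (y : ℕ → ℝ × I) : Measure (ℝ × Tree w) :=
  Measure.sum fun i =>
    Measure.dirac ((Real.Gamma (k + 1) * (y i).1) ^ (1 / k), proj w (y i).2)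

/-- The part of the tree still connected to the root at time `t` in the time-changed cutting. -/
def remainingTree (k : ℝ) (w : C(I, ℝ)) (y : ℕ → ℝ × I) (t : ℝ) : Set (Tree w) :=
  {x | cutMeasureTilde k w y (Icc 0 t ×ˢ segment (root w) x) = 0}

/-- `X_k = ∫_0^∞ μ(remaining tree at time t) dt`, as an element of `[0, ∞]`. -/
def X (k : ℝ) (w : C(I, ℝ)) (y : ℕ → ℝ × I) : ℝ≥0∞ :=
  ∫⁻ t in Ici (0 : ℝ), massMeasure w (remainingTree k w y t)

/-- The increment `Δ_r`: `w (s r) - max_{i < r} b (s i) (s r)`, and `w (s r)` for the first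
index `r`. -/
def Δ (w : C(I, ℝ)) {q : ℕ} (s : Fin q → I) (r : Fin q) : ℝ :=
  if h : (Finset.Iio r).Nonempty then
    w (s r) - (Finset.Iio r).sup' h (fun i => b w (s i) (s r))
  else w (s r)

/-! ### Poisson random measures -/

/-- Under `P`, the random measure `N` is a Poisson random measure with intensity `ν`. -/
structure IsPoissonRandomMeasure {Ω E : Type*} [MeasurableSpace Ω] [MeasurableSpace E]
    (N : Ω → Measure E) (ν : Measure E) (P : Measure Ω) : Prop where
  aemeasurable : ∀ B : Set E, MeasurableSet B → AEMeasurable (fun ω => N ω B) P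
  map_eq : ∀ B : Set E, MeasurableSet B → ν B ≠ ∞ →
    P.map (fun ω => N ω B) = (poissonMeasure (ν B).toNNReal).map (fun n : ℕ => (n : ℝ≥0∞))
  eq_top : ∀ B : Set E, MeasurableSet B → ν B = ∞ → ∀ᵐ ω ∂P, N ω B = ∞
  indep : ∀ (n : ℕ) (B : Fin n → Set E), (∀ i, MeasurableSet (B i)) →
    Pairwise (fun i j => Disjoint (B i) (B j)) → iIndepFun (fun i ω => N ω (B i)) P

/-! ### The normalised Brownian excursion -/

instance : MeasurableSpace C(I, ℝ) := borel _

instance : BorelSpace C(I, ℝ) := ⟨rfl⟩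

/-- The density at time `t` of the first hitting time of `0` by Brownian motion started
from `x > 0`. -/
def hittingDensity (t x : ℝ) : ℝ :=
  x / √(2 * Real.pi * t ^ 3) * Real.exp (-x ^ 2 / (2 * t))

/-- The transition density of Brownian motion killed at `0`. -/
def killedDensity (t x y : ℝ) : ℝ :=
  1 / √(2 * Real.pi * t) *
    (Real.exp (-(x - y) ^ 2 / (2 * t)) - Real.exp (-(x + y) ^ 2 / (2 * t)))

/-- The joint density, at `x ∈ (0, ∞)^(n+1)`, of the standard Brownian excursion of duration `1`
at the times `0 < t 0 < ⋯ < t n < 1`. -/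
def excursionDensity {n : ℕ} (t x : Fin (n + 1) → ℝ) : ℝ :=
  2 * √(2 * Real.pi) * hittingDensity (t 0) (x 0) *
    (∏ i : Fin n, killedDensity (t i.succ - t i.castSucc) (x i.castSucc) (x i.succ)) *
    hittingDensity (1 - t (Fin.last n)) (x (Fin.last n))

/-- The continuous process `ξ` is, under `P`, a standard normalised Brownian excursion of
duration `1`: it vanishes at `0` and `1` and has the excursion's finite-dimensional laws. -/
structure IsNormalizedExcursion {Ω : Type*} [MeasurableSpace Ω] (ξ : Ω → C(I, ℝ))
    (P : Measure Ω) : Prop where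
  measurable : Measurable ξ
  zero : ∀ᵐ ω ∂P, ξ ω 0 = 0
  one : ∀ᵐ ω ∂P, ξ ω 1 = 0
  map_eq : ∀ (n : ℕ) (t : Fin (n + 1) → I), StrictMono t → (∀ i, 0 < t i ∧ t i < 1) →
    P.map (fun ω i => ξ ω (t i)) =
      ((volume : Measure (Fin (n + 1) → ℝ)).restrict {x | ∀ i, 0 < x i}).withDensity
        (fun x => ENNReal.ofReal (excursionDensity (fun i => (t i : ℝ)) x))

end CRT

end

/-! Fix a coding function `w ≥ 0` with `w 0 = 0`. By Tonelli, the `q`-th power of `X k` is the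
integral, over times `t` and points `s`, of the indicator that each `proj w (s r)` is still joined
to the root at time `t r`. Averaged over the cuts and integrated over `s`, this is symmetric in `t`,
so the integral is `q !` times the one over strictly decreasing times
(`lintegral_eq_factorial_mul_setLIntegral_strictAnti`).

For decreasing times `x`, put `τ r = x r ^ k / Γ(k + 1)`, the original time corresponding to `x r`.
All points are connected exactly when no cut falls in the union of the sets `[0, τ r] × ⟦root, s
r⟧`. Segments of smaller index are watched for longer, so replacing each segment by the branch it
adds to the earlier ones leaves the union unchanged and makes it disjoint
(`iUnion_prod_segment_root`). The branch has length `Δ w s r` (`lengthMeasure_branch`): height maps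
the segment isometrically onto `[0, w (s r)]`, and the segment shares with that of `s i` precisely
the heights up to `b w (s i) (s r)`. The Poisson void probability is then `exp (-∑ Δ r * τ r)`.

Disintegrating the law of `(e, Y)` along `e` turns this into the conditional statement. Of the
excursion, only nonnegativity and the value `0` at time `0` matter. -/

namespace CRT

/-! ### Geometry of the tree coded by a nonnegative function -/

section Geometry

variable {w : C(I, ℝ)}

lemma dist_root (h0 : w 0 = 0) (hw : ∀ s, 0 ≤ w s) (s : I) : dist (root w) (proj w s) = w s := by
  have h1 : b w 0 s ≤ w 0 := b_le w left_mem_uIcc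
  obtain ⟨u, -, hu⟩ := exists_b_eq w 0 s
  have h2 := hw u
  rw [root, dist_proj]
  linarith

lemma mem_segment_root_iff (h0 : w 0 = 0) (hw : ∀ s, 0 ≤ w s) (u s : I) :
    proj w u ∈ segment (root w) (proj w s) ↔ w u = b w u s := by
  rw [segment, mem_ofPred_eq, dist_root h0 hw, dist_root h0 hw, dist_proj]
  constructor <;> intro h <;> linarith

lemma exists_proj_eq (z : Tree w) : ∃ s : I, proj w s = z := by
  obtain ⟨s, rfl⟩ := SeparationQuotient.surjective_mk z
  exact ⟨s, rfl⟩

/-- Two segments from the root coincide up to the height `b w s' s` and separate above it. Both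
directions are the ultrametric inequality `min_b_le`. -/
lemma mem_segment_root_iff_le (h0 : w 0 = 0) (hw : ∀ s, 0 ≤ w s) {u s : I}
    (hu : w u = b w u s) (s' : I) :
    proj w u ∈ segment (root w) (proj w s') ↔ w u ≤ b w s' s := by
  rw [mem_segment_root_iff h0 hw]
  constructor
  · intro h
    have h1 := min_b_le w s' u s
    rwa [b_comm w s' u, ← hu, ← h, min_self] at h1
  · intro h
    have h1 := min_b_le w u s s'
    rw [← hu, b_comm w s s', min_eq_left h] at h1
    exact le_antisymm h1 (b_le w left_mem_uIcc)

/-- For two ancestors of the same point, `min_b_le` forces `b w u u'` to be the smaller of their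
heights. -/
lemma dist_eq_of_mem_segment_root (h0 : w 0 = 0) (hw : ∀ s, 0 ≤ w s) {s : I} {z z' : Tree w}
    (hz : z ∈ segment (root w) (proj w s)) (hz' : z' ∈ segment (root w) (proj w s)) :
    dist z z' = |dist (root w) z - dist (root w) z'| := by
  obtain ⟨u, rfl⟩ := exists_proj_eq z
  obtain ⟨u', rfl⟩ := exists_proj_eq z'
  rw [mem_segment_root_iff h0 hw] at hz hz'
  rw [dist_root h0 hw, dist_root h0 hw, dist_proj]
  have h1 := min_b_le w u s u'
  rw [b_comm w s u', ← hz, ← hz'] at h1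
  have h2 : b w u u' ≤ w u := b_le w left_mem_uIcc
  have h3 : b w u u' ≤ w u' := b_le w right_mem_uIcc
  rcases le_total (w u) (w u') with h | h
  · rw [min_eq_left h] at h1
    rw [abs_of_nonpos (by linarith)]
    linarith
  · rw [min_eq_right h] at h1
    rw [abs_of_nonneg (by linarith)]
    linarith

/-- The segment from the root to `proj w s` has a point at every height below `w s`. -/
lemma exists_mem_segment_root_height (h0 : w 0 = 0) {s : I} {h : ℝ} (hh : 0 ≤ h)
    (hs : h ≤ w s) : ∃ u, w u = b w u s ∧ w u = h := by
  have hK : IsCompact {u : I | u ≤ s ∧ w u ≤ h} :=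
    (isClosed_Iic.inter (isClosed_Iic.preimage w.continuous)).isCompact
  -- The last time before `s` with height at most `h`: its height is `h` by the intermediate value
  -- theorem, and `w` stays above `h` from there to `s`.
  obtain ⟨u, ⟨hus, huh⟩, hmax⟩ := hK.exists_isGreatest ⟨0, unitInterval.nonneg', by rwa [h0]⟩
  have hwu : w u = h := by
    obtain ⟨v, hv, hvh⟩ := intermediate_value_Icc hus w.continuous.continuousOn ⟨huh, hs⟩
    have : v = u := le_antisymm (hmax ⟨hv.2, hvh.le⟩) hv.1
    rw [← this, hvh]
  refine ⟨u, ?_, hwu⟩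
  obtain ⟨v, hv, hvb⟩ := exists_b_eq w u s
  refine le_antisymm ?_ (b_le w left_mem_uIcc)
  rw [uIcc_of_le hus] at hv
  rw [← hvb]
  by_contra! hlt
  have : v = u := le_antisymm (hmax ⟨hv.2, (hlt.trans_eq hwu).le⟩) hv.1
  exact lt_irrefl _ (this ▸ hlt)

lemma isClosed_segment {X : Type*} [MetricSpace X] (x y : X) : IsClosed (segment x y) :=
  isClosed_eq (by fun_prop) (by fun_prop)

lemma measurableSet_segment (x y : Tree w) : MeasurableSet (segment x y) :=
  (isClosed_segment x y).measurableSet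

/-- The height function is an isometry from the segment from the root to `proj w s`
onto `[0, w s]`. -/
lemma hausdorffMeasure_segment_root_inter (h0 : w 0 = 0) (hw : ∀ s, 0 ≤ w s) (s : I)
    (B : Set ℝ) :
    μH[1] (segment (root w) (proj w s) ∩ {z | dist (root w) z ∈ B}) =
      volume (Icc 0 (w s) ∩ B) := by
  set S := segment (root w) (proj w s) with hS
  let f : S → ℝ := fun z => dist (root w) z.1
  have hf : Isometry f := Isometry.of_dist_eq fun z z' => by
    rw [Real.dist_eq, Subtype.dist_eq, dist_eq_of_mem_segment_root h0 hw z.2 z'.2]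
  have h1 := hf.hausdorffMeasure_image (d := 1) (Or.inl zero_le_one) {z | f z ∈ B}
  have h2 := (isometry_subtype_coe (s := S)).hausdorffMeasure_image (d := 1)
    (Or.inl zero_le_one) {z | f z ∈ B}
  rw [← hausdorffMeasure_real]
  have h3 : S ∩ {z | dist (root w) z ∈ B} = (Subtype.val : S → Tree w) '' {z | f z ∈ B} := by
    ext z
    simp [f]
    tauto
  have h4 : Icc 0 (w s) ∩ B = f '' {z | f z ∈ B} := by
    ext h
    constructor
    · rintro ⟨hh, hB⟩
      obtain ⟨u, hu, rfl⟩ := exists_mem_segment_root_height h0 hh.1 hh.2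
      have hfu : f ⟨proj w u, (mem_segment_root_iff h0 hw u s).2 hu⟩ = w u := dist_root h0 hw u
      exact ⟨⟨proj w u, (mem_segment_root_iff h0 hw u s).2 hu⟩, by rwa [mem_ofPred_eq, hfu], hfu⟩
    · rintro ⟨z, hz, rfl⟩
      refine ⟨⟨dist_nonneg, ?_⟩, hz⟩
      have : dist (root w) z.1 + dist z.1 (proj w s) = dist (root w) (proj w s) := z.2
      rw [dist_root h0 hw] at this
      have h5 : 0 ≤ dist (z : Tree w) (proj w s) := dist_nonneg
      change dist (root w) z.1 ≤ w s
      linarith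
  rw [h3, h4, h1, h2]

/-- Only the two endpoints of a segment can lie off the skeleton, and points are null for `μH[1]`.
-/
lemma lengthMeasure_of_subset_segment_root {s : I} {A : Set (Tree w)} (hA : MeasurableSet A)
    (hAs : A ⊆ segment (root w) (proj w s)) : lengthMeasure w A = μH[1] A := by
  rw [lengthMeasure, Measure.restrict_apply hA]
  refine le_antisymm (measure_mono inter_subset_left) ?_
  have : NullSingletonClass (μH[1] : Measure (Tree w)) :=
    Measure.nullSingletonClass_hausdorff (Tree w) zero_lt_one
  have hnull : (μH[1] : Measure (Tree w)) {root w, proj w s} = 0 :=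
    ((finite_singleton _).insert _).countable.measure_zero _
  calc μH[1] A ≤ μH[1] ((A ∩ skeleton (Tree w)) ∪ {root w, proj w s}) := by
        refine measure_mono fun z hz => ?_
        by_cases h1 : z = root w
        · exact Or.inr (Or.inl h1)
        by_cases h2 : z = proj w s
        · exact Or.inr (Or.inr h2)
        exact Or.inl ⟨hz, root w, proj w s, hAs hz, h1, h2⟩
    _ ≤ μH[1] (A ∩ skeleton (Tree w)) + μH[1] {root w, proj w s} := measure_union_le _ _
    _ = _ := by rw [hnull, add_zero]

lemma lengthMeasure_segment_root (h0 : w 0 = 0) (hw : ∀ s, 0 ≤ w s) (s : I) :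
    lengthMeasure w (segment (root w) (proj w s)) = ENNReal.ofReal (w s) := by
  rw [lengthMeasure_of_subset_segment_root (measurableSet_segment _ _) subset_rfl]
  simpa using hausdorffMeasure_segment_root_inter h0 hw s univ

/-- A skeleton point is a strict ancestor of some `s`. By continuity of `w` it remains an ancestor
of every `r` near `s`, in particular of a term of the dense sequence. This gives the countable cover
behind σ-finiteness. -/
lemma skeleton_subset (h0 : w 0 = 0) (hw : ∀ s, 0 ≤ w s) :
    skeleton (Tree w) ⊆
      ⋃ n, segment (root w) (proj w (TopologicalSpace.denseSeq I n)) := by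
  have key : ∀ u s : I, w u = b w u s → proj w u ≠ proj w s →
      proj w u ∈ ⋃ n, segment (root w) (proj w (TopologicalSpace.denseSeq I n)) := by
    intro u s hus hne
    have hlt : w u < w s := by
      have h1 : 0 < dist (proj w u) (proj w s) := dist_pos.2 hne
      rw [dist_proj] at h1
      linarith
    have hev : ∀ᶠ r in 𝓝 s, w u ≤ b w r s := by
      obtain ⟨δ, hδ, hball⟩ := Metric.isOpen_iff.1 (isOpen_lt continuous_const w.continuous) s hlt
      filter_upwards [Metric.ball_mem_nhds s hδ] with r hr
      obtain ⟨v, hv, hvb⟩ := exists_b_eq w r s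
      rw [← hvb]
      refine le_of_lt (hball (Metric.mem_ball.2 (lt_of_le_of_lt ?_ (Metric.mem_ball.1 hr))))
      rw [uIcc_comm] at hv
      have := abs_sub_left_of_mem_uIcc (a := (s : ℝ)) (b := r) (c := v) (by
        rcases mem_uIcc.1 hv with h | h
        · exact mem_uIcc.2 (Or.inl h)
        · exact mem_uIcc.2 (Or.inr h))
      simpa [Subtype.dist_eq, Real.dist_eq] using this
    obtain ⟨r, ⟨n, rfl⟩, hr⟩ :=
      (mem_closure_iff_frequently.1 (TopologicalSpace.denseRange_denseSeq I s)).and_eventually hev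
        |>.exists
    exact mem_iUnion.2 ⟨n, (mem_segment_root_iff_le h0 hw hus _).2 hr⟩
  rintro z ⟨x, y, hz, hx, hy⟩
  obtain ⟨u, rfl⟩ := exists_proj_eq z
  obtain ⟨s, rfl⟩ := exists_proj_eq x
  obtain ⟨t, rfl⟩ := exists_proj_eq y
  rw [segment, mem_ofPred_eq, dist_proj, dist_proj, dist_proj] at hz
  have h1 := min_b_le w s u t
  have h2 : b w s u ≤ w u := b_le w right_mem_uIcc
  have h3 : b w u t ≤ w u := b_le w left_mem_uIcc
  -- `hz` says `w u = b w s u + b w u t - b w s t`, so a point between `s` and `t` is an ancestor of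
  -- one of them.
  rcases min_le_iff.1 h1 with h | h
  · exact key u t (by linarith) hy
  · exact key u s (by rw [b_comm]; linarith) hx

lemma sigmaFinite_lengthMeasure (h0 : w 0 = 0) (hw : ∀ s, 0 ≤ w s) :
    SigmaFinite (lengthMeasure w) := by
  set f : ℕ → Set (Tree w) :=
    fun n => segment (root w) (proj w (TopologicalSpace.denseSeq I n)) with hf
  refine Measure.sigmaFinite_of_countable (S := insert (⋃ n, f n)ᶜ (range f))
    ((countable_range f).insert _) ?_ ?_
  · rintro s (rfl | ⟨n, rfl⟩)
    · rw [lengthMeasure, Measure.restrict_apply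
        (MeasurableSet.iUnion fun n => measurableSet_segment _ _).compl,
        (disjoint_compl_left_iff_subset.2 (skeleton_subset h0 hw)).inter_eq, measure_empty]
      exact ENNReal.zero_lt_top
    · rw [hf, lengthMeasure_segment_root h0 hw]
      exact ENNReal.ofReal_lt_top
  · rw [sUnion_insert, sUnion_range, compl_union_self]

/-- The part of the segment from the root to `proj w (s r)` that is not on an earlier segment. -/
def branch (w : C(I, ℝ)) {q : ℕ} (s : Fin q → I) (r : Fin q) : Set (Tree w) :=
  segment (root w) (proj w (s r)) \ ⋃ i ∈ Finset.Iio r, segment (root w) (proj w (s i))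

lemma measurableSet_branch {q : ℕ} (s : Fin q → I) (r : Fin q) :
    MeasurableSet (branch w s r) :=
  (measurableSet_segment _ _).diff
    (Finset.measurableSet_biUnion _ fun _ _ => measurableSet_segment _ _)

lemma Δ_nonneg (hw : ∀ s, 0 ≤ w s) {q : ℕ} (s : Fin q → I) (r : Fin q) : 0 ≤ Δ w s r := by
  rw [Δ]
  split_ifs with h
  · exact sub_nonneg.2 (Finset.sup'_le _ _ fun i _ => b_le w right_mem_uIcc)
  · exact hw _

lemma lengthMeasure_branch (h0 : w 0 = 0) (hw : ∀ s, 0 ≤ w s) {q : ℕ} (s : Fin q → I)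
    (r : Fin q) : lengthMeasure w (branch w s r) = ENNReal.ofReal (Δ w s r) := by
  rw [lengthMeasure_of_subset_segment_root (measurableSet_branch s r) sdiff_subset, Δ]
  split_ifs with h
  · have hb : branch w s r = segment (root w) (proj w (s r)) ∩ {z | dist (root w) z ∈
        Ioi ((Finset.Iio r).sup' h (fun i => b w (s i) (s r)))} := by
      ext z
      obtain ⟨u, rfl⟩ := exists_proj_eq z
      simp only [branch, Set.mem_sdiff, mem_inter_iff, mem_iUnion, mem_ofPred_eq, mem_Ioi,
        dist_root h0 hw, Finset.sup'_lt_iff]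
      refine and_congr_right fun hu => ?_
      rw [mem_segment_root_iff h0 hw] at hu
      simp only [mem_segment_root_iff_le h0 hw hu, not_exists, not_le]
    -- The branching height is nonnegative, so `Icc 0 (w (s r))` does not truncate the interval of
    -- heights from below.
    have hm : 0 ≤ (Finset.Iio r).sup' h (fun i => b w (s i) (s r)) := by
      obtain ⟨i, hi⟩ := h
      refine le_trans ?_ (Finset.le_sup' (fun i => b w (s i) (s r)) hi)
      obtain ⟨u, -, hu⟩ := exists_b_eq w (s i) (s r)
      rw [← hu]
      exact hw u
    have hIoc : Icc 0 (w (s r)) ∩ Ioi ((Finset.Iio r).sup' h (fun i => b w (s i) (s r))) =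
        Ioc ((Finset.Iio r).sup' h (fun i => b w (s i) (s r))) (w (s r)) := by
      ext x
      simp only [mem_inter_iff, mem_Icc, mem_Ioi, mem_Ioc]
      constructor
      · rintro ⟨⟨-, h1⟩, h2⟩
        exact ⟨h2, h1⟩
      · rintro ⟨h1, h2⟩
        exact ⟨⟨hm.trans h1.le, h2⟩, h1⟩
    rw [hb, hausdorffMeasure_segment_root_inter h0 hw, hIoc, Real.volume_Ioc]
  · have hb : branch w s r =
        segment (root w) (proj w (s r)) ∩ {z | dist (root w) z ∈ univ} := by
      simp [branch, Finset.not_nonempty_iff_eq_empty.1 h]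
    rw [hb, hausdorffMeasure_segment_root_inter h0 hw, inter_univ, Real.volume_Icc, sub_zero]

end Geometry

/-! ### Void probabilities -/

section Poisson

lemma IsPoissonRandomMeasure.measure_eq_zero {Ω E : Type*} [MeasurableSpace Ω]
    [MeasurableSpace E] {N : Ω → Measure E} {ν : Measure E} {P : Measure Ω}
    (h : IsPoissonRandomMeasure N ν P) {B : Set E} (hB : MeasurableSet B) {a : ℝ} (ha : 0 ≤ a)
    (hν : ν B = ENNReal.ofReal a) : P {ω | N ω B = 0} = ENNReal.ofReal (Real.exp (-a)) := by
  have h1 := h.map_eq B hB (by rw [hν]; exact ENNReal.ofReal_ne_top)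
  have h2 : P {ω | N ω B = 0} = (P.map fun ω => N ω B) {0} :=
    (Measure.map_apply_of_aemeasurable (h.aemeasurable B hB) (measurableSet_singleton _)).symm
  have h3 : (fun n : ℕ => (n : ℝ≥0∞)) ⁻¹' {0} = {0} := by
    ext n
    simp
  rw [h2, h1, Measure.map_apply (by fun_prop) (measurableSet_singleton _), h3,
    poissonMeasure_singleton, hν, ENNReal.coe_toNNReal_eq_toReal,
    ENNReal.toReal_ofReal ha]
  simp

variable {w : C(I, ℝ)} {y : ℕ → ℝ × I}

lemma cutMeasure_eq_zero_iff {B : Set (ℝ × Tree w)} (hB : MeasurableSet B) :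
    cutMeasure w y B = 0 ↔ ∀ i, ((y i).1, proj w (y i).2) ∉ B := by
  rw [cutMeasure, Measure.sum_apply _ hB, ENNReal.tsum_eq_zero]
  exact forall_congr' fun i => by simp [Measure.dirac_apply' _ hB]

lemma proj_mem_remainingTree_iff {k : ℝ} {t : ℝ} {s : I} :
    proj w s ∈ remainingTree k w y t ↔
      ∀ i, (Real.Gamma (k + 1) * (y i).1) ^ (1 / k) ∈ Icc 0 t →
        proj w (y i).2 ∉ segment (root w) (proj w s) := by
  have hB : MeasurableSet (Icc 0 t ×ˢ segment (root w) (proj w s)) :=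
    measurableSet_Icc.prod (measurableSet_segment _ _)
  rw [remainingTree, mem_ofPred_eq, cutMeasureTilde, Measure.sum_apply _ hB,
    ENNReal.tsum_eq_zero]
  exact forall_congr' fun i => by simp [Measure.dirac_apply' _ hB]

/-- The space-time region that must be free of cuts for `proj w (s r)` to be connected to the root
at time `τ r`, for all `r`; it is the disjoint union of the products of `[0, τ r]` and the
branches when `τ` is decreasing. -/
lemma iUnion_prod_segment_root {q : ℕ} {τ : Fin q → ℝ} (hτ : Antitone τ) (s : Fin q → I) :
    ⋃ r, Icc 0 (τ r) ×ˢ segment (root w) (proj w (s r)) =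
      ⋃ r, Icc 0 (τ r) ×ˢ branch w s r := by
  refine subset_antisymm (iUnion_subset fun r => ?_)
    (iUnion_mono fun r => prod_mono subset_rfl sdiff_subset)
  -- A point already on an earlier segment is passed down to that index, whose time window is at
  -- least as long.
  induction r using WellFoundedLT.induction with
  | ind r ih =>
    rintro ⟨t, z⟩ ⟨ht, hz⟩
    by_cases h : ∃ i < r, z ∈ segment (root w) (proj w (s i))
    · obtain ⟨i, hi, hzi⟩ := h
      exact ih i hi ⟨⟨ht.1, ht.2.trans (hτ hi.le)⟩, hzi⟩
    · push Not at h
      refine mem_iUnion.2 ⟨r, ht, hz, ?_⟩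
      simpa using h

lemma pairwise_disjoint_branch {q : ℕ} (s : Fin q → I) :
    Pairwise (Function.onFun Disjoint (branch w s)) := by
  have key : ∀ i j, i < j → Disjoint (branch w s i) (branch w s j) := by
    intro i j hij
    rw [Set.disjoint_left]
    intro z hi hj
    exact hj.2 (mem_biUnion (Finset.mem_Iio.2 hij) hi.1)
  intro i j hij
  rcases lt_or_gt_of_ne hij with h | h
  · exact key i j h
  · exact (key j i h).symm

lemma prod_lengthMeasure_iUnion (h0 : w 0 = 0) (hw : ∀ s, 0 ≤ w s) {q : ℕ} {τ : Fin q → ℝ}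
    (hτ0 : ∀ r, 0 ≤ τ r) (hτ : Antitone τ) (s : Fin q → I) :
    (((volume : Measure ℝ).restrict (Ici 0)).prod (lengthMeasure w))
      (⋃ r, Icc 0 (τ r) ×ˢ segment (root w) (proj w (s r))) =
        ENNReal.ofReal (∑ r, Δ w s r * τ r) := by
  have := sigmaFinite_lengthMeasure h0 hw
  rw [iUnion_prod_segment_root hτ, measure_iUnion
    (fun i j hij => (pairwise_disjoint_branch s hij).set_prod_right _ _)
    (fun r => measurableSet_Icc.prod (measurableSet_branch s r)), tsum_fintype,
    ENNReal.ofReal_sum_of_nonneg fun r _ => mul_nonneg (Δ_nonneg hw s r) (hτ0 r)]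
  refine Finset.sum_congr rfl fun r _ => ?_
  rw [Measure.prod_prod, lengthMeasure_branch h0 hw, Measure.restrict_apply measurableSet_Icc,
    inter_eq_left.2 Icc_subset_Ici_self, Real.volume_Icc, sub_zero,
    ENNReal.ofReal_mul (Δ_nonneg hw s r), mul_comm]

lemma rpow_mem_Icc_iff {k : ℝ} (hk : 0 < k) {a t x : ℝ} (ha : 0 < a) (ht : 0 ≤ t) (hx : 0 ≤ x) :
    (a * t) ^ (1 / k) ∈ Icc 0 x ↔ t ∈ Icc 0 (1 / a * x ^ k) := by
  have hat : 0 ≤ a * t := by positivity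
  rw [mem_Icc, mem_Icc, and_iff_right (by positivity), and_iff_right ht, one_div k,
    Real.rpow_inv_le_iff_of_pos hat hx hk, one_div, inv_mul_eq_div, le_div_iff₀ ha, mul_comm]

lemma measure_forall_proj_mem_remainingTree (h0 : w 0 = 0) (hw : ∀ s, 0 ≤ w s)
    {Q : Measure (ℕ → ℝ × I)}
    (hQ : IsPoissonRandomMeasure (cutMeasure w)
      (((volume : Measure ℝ).restrict (Ici 0)).prod (lengthMeasure w)) Q)
    {k : ℝ} (hk : 0 < k) {q : ℕ} {x : Fin q → ℝ} (hx0 : ∀ r, 0 < x r) (hx : StrictAnti x)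
    (s : Fin q → I) [IsProbabilityMeasure Q] :
    Q {y | ∀ r, proj w (s r) ∈ remainingTree k w y (x r)} =
      ENNReal.ofReal (Real.exp (-(1 / Real.Gamma (k + 1)) * ∑ r, Δ w s r * x r ^ k)) := by
  have hΓ : 0 < Real.Gamma (k + 1) := Real.Gamma_pos_of_pos (by linarith)
  have := sigmaFinite_lengthMeasure h0 hw
  set τ : Fin q → ℝ := fun r => 1 / Real.Gamma (k + 1) * x r ^ k with hτdef
  have hτ0 : ∀ r, 0 ≤ τ r := fun r => by have := hx0 r; positivity
  have hτ : Antitone τ := fun i j hij =>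
    mul_le_mul_of_nonneg_left
      (Real.rpow_le_rpow (hx0 j).le (hx.antitone hij) hk.le) (by positivity)
  -- The intensity does not charge negative times. Such cuts must be excluded because `rpow` at a
  -- negative base may take values in `[0, x r]`.
  have hneg : ∀ᵐ y ∂Q, ∀ i, 0 ≤ (y i).1 := by
    have hB : MeasurableSet (Iio (0 : ℝ) ×ˢ (univ : Set (Tree w))) :=
      measurableSet_Iio.prod MeasurableSet.univ
    have h1 := hQ.measure_eq_zero hB le_rfl (by
      rw [Measure.prod_prod, Measure.restrict_apply measurableSet_Iio, Iio_inter_Ici, Ico_self]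
      simp)
    rw [neg_zero, Real.exp_zero, ENNReal.ofReal_one] at h1
    have h2 : ∀ᵐ y ∂Q, cutMeasure w y (Iio (0 : ℝ) ×ˢ (univ : Set (Tree w))) = 0 :=
      (mem_ae_iff_prob_eq_one₀ ((hQ.aemeasurable _ hB).nullMeasurableSet_preimage
        (measurableSet_singleton 0))).2 h1
    filter_upwards [h2] with y hy i
    rw [cutMeasure_eq_zero_iff hB] at hy
    simpa using hy i
  have hB : MeasurableSet (⋃ r, Icc 0 (τ r) ×ˢ segment (root w) (proj w (s r))) :=
    MeasurableSet.iUnion fun r => measurableSet_Icc.prod (measurableSet_segment _ _)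
  have h1 := hQ.measure_eq_zero hB
    (Finset.sum_nonneg fun r _ => mul_nonneg (Δ_nonneg hw s r) (hτ0 r))
    (prod_lengthMeasure_iUnion h0 hw hτ0 hτ s)
  have h2 : -(1 / Real.Gamma (k + 1)) * ∑ r, Δ w s r * x r ^ k = -∑ r, Δ w s r * τ r := by
    rw [neg_mul, Finset.mul_sum]
    exact congrArg _ (Finset.sum_congr rfl fun r _ => mul_left_comm _ _ _)
  rw [h2, ← h1]
  refine measure_congr ?_
  filter_upwards [hneg] with y hy
  refine propext ?_
  change (∀ r, proj w (s r) ∈ remainingTree k w y (x r)) ↔ cutMeasure w y _ = 0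
  rw [cutMeasure_eq_zero_iff hB]
  simp only [proj_mem_remainingTree_iff, mem_iUnion, mem_prod, not_exists, not_and]
  rw [forall_comm]
  exact forall₂_congr fun i r => by rw [rpow_mem_Icc_iff hk hΓ (hy i) (hx0 r).le]

end Poisson

end CRT

/-! ### Integration over finite products -/

section Pi

lemma lintegral_fin_nat_prod_eq_prod {n : ℕ} {α : Type*} [MeasurableSpace α] {μ : Measure α}
    [SigmaFinite μ] {f : Fin n → α → ℝ≥0∞} (hf : ∀ i, Measurable (f i)) :
    ∫⁻ x : Fin n → α, ∏ i, f i (x i) ∂(Measure.pi fun _ => μ) = ∏ i, ∫⁻ x, f i x ∂μ := by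
  induction n with
  | zero => simp
  | succ n ih =>
    have hmeas : Measurable fun x : Fin n → α => ∏ i : Fin n, f i.succ (x i) :=
      Finset.measurable_prod _ fun i _ => (hf _).comp (measurable_pi_apply i)
    rw [← ((measurePreserving_piFinSuccAbove (fun _ : Fin (n + 1) => μ) 0).symm).lintegral_comp_emb
      (MeasurableEquiv.measurableEmbedding _)]
    rw [Fin.prod_univ_succ, ← ih fun i => hf i.succ,
      ← lintegral_prod_mul (hf 0).aemeasurable hmeas.aemeasurable]
    refine lintegral_congr fun x => ?_
    rw [Fin.prod_univ_succ]
    rfl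

lemma lintegral_comp_perm {n : ℕ} {α : Type*} [MeasureSpace α]
    [SigmaFinite (volume : Measure α)] (e : Equiv.Perm (Fin n)) (f : (Fin n → α) → ℝ≥0∞) :
    ∫⁻ x : Fin n → α, f (x ∘ e) = ∫⁻ x, f x := by
  rw [← (volume_measurePreserving_piCongrLeft (fun _ : Fin n => α) e).lintegral_comp_emb
    (MeasurableEquiv.measurableEmbedding _)]
  refine lintegral_congr fun x => congrArg f ?_
  ext i
  exact Equiv.piCongrLeft_apply_apply (P := fun _ : Fin n => α) e x i

lemma measurableSet_strictAnti (n : ℕ) : MeasurableSet {x : Fin n → ℝ | StrictAnti x} := by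
  simp only [StrictAnti, ofPred_forall]
  exact MeasurableSet.iInter fun i => MeasurableSet.iInter fun j => MeasurableSet.iInter fun _ =>
    measurableSet_lt (measurable_pi_apply j) (measurable_pi_apply i)

lemma ae_injective (n : ℕ) : ∀ᵐ x : Fin n → ℝ, Function.Injective x := by
  have key : ∀ i j : Fin n, i ≠ j → ∀ᵐ x : Fin n → ℝ, x i ≠ x j := by
    intro i j hij
    let L : (Fin n → ℝ) →ₗ[ℝ] ℝ := (LinearMap.proj i : (Fin n → ℝ) →ₗ[ℝ] ℝ) - LinearMap.proj j
    -- The diagonal `x i = x j` is a proper subspace, hence null.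
    have h := Measure.addHaar_submodule (volume : Measure (Fin n → ℝ)) (LinearMap.ker L) (by
      intro htop
      have : Pi.single i (1 : ℝ) ∈ LinearMap.ker L := htop ▸ Submodule.mem_top
      simp [L, hij] at this)
    refine measure_mono_null (fun x hx => ?_) h
    simpa [L, sub_eq_zero] using hx
  have h : ∀ᵐ x : Fin n → ℝ, ∀ i j, i ≠ j → x i ≠ x j :=
    ae_all_iff.2 fun i => ae_all_iff.2 fun j => by
      by_cases hij : i = j
      · simp [hij]
      · simpa [hij] using key i j hij
  filter_upwards [h] with x hx i j hij
  by_contra hne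
  exact hx i j hne hij

/-- Sorting `-x` gives existence. Two sorted rearrangements agree as sequences, and injectivity of
`x` then identifies the permutations. -/
lemma existsUnique_strictAnti_comp_perm {n : ℕ} {x : Fin n → ℝ} (hx : Function.Injective x) :
    ∃! e : Equiv.Perm (Fin n), StrictAnti (x ∘ e) := by
  refine ⟨Tuple.sort fun i => -x i, ?_, fun τ hτ => ?_⟩
  · have h1 : Monotone ((fun i => -x i) ∘ Tuple.sort fun i => -x i) := Tuple.monotone_sort _
    have h2 := h1.strictMono_of_injective
      ((neg_injective.comp hx).comp (Tuple.sort fun i => -x i).injective)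
    exact fun i j hij => neg_lt_neg_iff.1 (h2 hij)
  · have h1 : Monotone ((fun i => -x i) ∘ τ) := fun i j hij => neg_le_neg (hτ.antitone hij)
    have h2 := Tuple.unique_monotone h1 (Tuple.monotone_sort fun i => -x i)
    exact Equiv.ext fun i => hx (neg_injective (congrFun h2 i))

/-- Almost every point lies in exactly one of the `n !` permuted copies of the decreasing chamber,
and by symmetry these contribute equally. -/
lemma lintegral_eq_factorial_mul_setLIntegral_strictAnti {n : ℕ} {f : (Fin n → ℝ) → ℝ≥0∞}
    (hf : Measurable f) (hsymm : ∀ (e : Equiv.Perm (Fin n)) x, f (x ∘ e) = f x) :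
    ∫⁻ x, f x = (n ! : ℝ≥0∞) * ∫⁻ x in {x | StrictAnti x}, f x := by
  set S : Set (Fin n → ℝ) := {x | StrictAnti x} with hS
  have hmS : MeasurableSet S := measurableSet_strictAnti n
  have hsum : ∀ᵐ x : Fin n → ℝ, f x = ∑ e : Equiv.Perm (Fin n), S.indicator f (x ∘ e) := by
    filter_upwards [ae_injective n] with x hx
    obtain ⟨e, he, huniq⟩ := existsUnique_strictAnti_comp_perm hx
    rw [Finset.sum_eq_single e, indicator_of_mem (show x ∘ e ∈ S from he), hsymm]
    · intro τ _ hτ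
      exact indicator_of_notMem (fun h => hτ (huniq τ h)) _
    · simp
  have hcomp : ∀ e : Equiv.Perm (Fin n), Measurable fun x : Fin n → ℝ => S.indicator f (x ∘ e) :=
    fun e => (hf.indicator hmS).comp
      (measurable_pi_lambda _ fun i => measurable_pi_apply (e i))
  rw [lintegral_congr_ae hsum, lintegral_finsetSum _ fun e _ => hcomp e]
  simp_rw [lintegral_comp_perm _ (S.indicator f)]
  rw [lintegral_indicator hmS, Finset.sum_const, Finset.card_univ, Fintype.card_perm,
    Fintype.card_fin, nsmul_eq_mul]

end Pi

namespace CRT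

/-! ### Measurability -/

section Measurability

lemma continuous_b : Continuous fun p : C(I, ℝ) × I × I => b p.1 p.2.1 p.2.2 := by
  -- Clamping `r` to the interval rewrites `b` as an infimum over the fixed compact set `I`, which
  -- is continuous in the parameters.
  have h : ∀ p : C(I, ℝ) × I × I, b p.1 p.2.1 p.2.2 =
      sInf ((fun r : I => p.1 (max (p.2.1 ⊓ p.2.2) (min r (p.2.1 ⊔ p.2.2)))) '' univ) := by
    rintro ⟨w, s, t⟩
    rw [b]
    congr 1
    ext x
    constructor
    · rintro ⟨u, hu, rfl⟩
      refine ⟨u, mem_univ _, congrArg w ?_⟩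
      rw [min_eq_left hu.2, max_eq_right hu.1]
    · rintro ⟨r, -, rfl⟩
      exact ⟨_, ⟨le_max_left _ _, max_le inf_le_sup (min_le_right _ _)⟩, rfl⟩
  simp only [h]
  exact isCompact_univ.continuous_sInf (by fun_prop)

lemma measurable_dist_proj_comp {α : Type*} [MeasurableSpace α] {w : α → C(I, ℝ)} {f g : α → I}
    (hw : Measurable w) (hf : Measurable f) (hg : Measurable g) :
    Measurable fun p => dist (proj (w p) (f p)) (proj (w p) (g p)) := by
  have hev : Measurable fun p : C(I, ℝ) × I => p.1 p.2 :=
    (by fun_prop : Continuous fun p : C(I, ℝ) × I => p.1 p.2).measurable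
  have hb := continuous_b.measurable.comp (hw.prodMk (hf.prodMk hg))
  simp only [dist_proj]
  exact ((hev.comp (hw.prodMk hf)).add (hev.comp (hw.prodMk hg))).sub (hb.const_mul 2)

lemma continuous_Δ {q : ℕ} (r : Fin q) :
    Continuous fun p : C(I, ℝ) × (Fin q → I) => Δ p.1 p.2 r := by
  by_cases h : (Finset.Iio r).Nonempty
  · simp only [Δ, dif_pos h]
    refine Continuous.sub (by fun_prop) (Continuous.finset_sup'_apply h fun i _ => ?_)
    exact continuous_b.comp (f := fun p : C(I, ℝ) × (Fin q → I) => (p.1, p.2 i, p.2 r))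
      (by fun_prop)
  · simp only [Δ, dif_neg h]
    fun_prop

lemma measurableSet_setOf_mem_segment_root {α : Type*} [MeasurableSpace α] {w : α → C(I, ℝ)}
    {f g : α → I} (hw : Measurable w) (hf : Measurable f) (hg : Measurable g) :
    MeasurableSet {p | proj (w p) (f p) ∈ segment (root (w p)) (proj (w p) (g p))} :=
  measurableSet_eq_fun
    ((measurable_dist_proj_comp hw measurable_const hf).add (measurable_dist_proj_comp hw hf hg))
    (measurable_dist_proj_comp hw measurable_const hg)

/-- The set of all `(w, y, t, s)` such that `0 < t` and, for the tree coded by `w` with cuts `y`,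
the point `proj w s` is still connected to the root at time `t`. -/
def connectedSet (k : ℝ) : Set (C(I, ℝ) × (ℕ → ℝ × I) × ℝ × I) :=
  {p | 0 < p.2.2.1 ∧ proj p.1 p.2.2.2 ∈ remainingTree k p.1 p.2.1 p.2.2.1}

lemma measurableSet_setOf_proj_mem_remainingTree (k : ℝ) {α : Type*} [MeasurableSpace α]
    {w : α → C(I, ℝ)} {y : α → ℕ → ℝ × I} {t : α → ℝ} {s : α → I} (hw : Measurable w)
    (hy : Measurable y) (ht : Measurable t) (hs : Measurable s) :
    MeasurableSet {p | proj (w p) (s p) ∈ remainingTree k (w p) (y p) (t p)} := by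
  have hyi : ∀ i, Measurable fun p => y p i := fun i => (measurable_pi_apply i).comp hy
  have hτ : ∀ i, Measurable fun p => (Real.Gamma (k + 1) * (y p i).1) ^ (1 / k) :=
    fun i => ((hyi i).fst.const_mul _).pow_const _
  have h : {p | proj (w p) (s p) ∈ remainingTree k (w p) (y p) (t p)} =
      ⋂ i, ({p | 0 ≤ (Real.Gamma (k + 1) * (y p i).1) ^ (1 / k)} ∩
        {p | (Real.Gamma (k + 1) * (y p i).1) ^ (1 / k) ≤ t p})ᶜ ∪
        {p | proj (w p) (y p i).2 ∈ segment (root (w p)) (proj (w p) (s p))}ᶜ := by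
    refine Set.ext fun p => proj_mem_remainingTree_iff.trans ?_
    rw [mem_iInter]
    exact forall_congr' fun i => imp_iff_not_or
  rw [h]
  exact MeasurableSet.iInter fun i =>
    ((measurableSet_le measurable_const (hτ i)).inter (measurableSet_le (hτ i) ht)).compl.union
      (measurableSet_setOf_mem_segment_root hw (hyi i).snd hs).compl

lemma measurableSet_connectedSet (k : ℝ) : MeasurableSet (connectedSet k) :=
  (measurableSet_lt measurable_const measurable_snd.snd.fst).inter
    (measurableSet_setOf_proj_mem_remainingTree k measurable_fst measurable_snd.fst
      measurable_snd.snd.fst measurable_snd.snd.snd)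

lemma measurableSet_remainingTree (k : ℝ) (w : C(I, ℝ)) (y : ℕ → ℝ × I) (t : ℝ) :
    MeasurableSet (remainingTree k w y t) := by
  have h : remainingTree k w y t = ⋂ i, {x | (Real.Gamma (k + 1) * (y i).1) ^ (1 / k) ∈ Icc 0 t →
      proj w (y i).2 ∉ segment (root w) x} := by
    ext x
    obtain ⟨s, rfl⟩ := exists_proj_eq x
    rw [proj_mem_remainingTree_iff, mem_iInter]
    rfl
  rw [h]
  refine MeasurableSet.iInter fun i => ?_
  by_cases hi : (Real.Gamma (k + 1) * (y i).1) ^ (1 / k) ∈ Icc 0 t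
  · simp only [hi, forall_const]
    exact (isClosed_eq (by fun_prop) (by fun_prop)).measurableSet.compl
  · simp only [hi, false_imp_iff, ofPred_true, MeasurableSet.univ]

lemma X_eq_lintegral (k : ℝ) (w : C(I, ℝ)) (y : ℕ → ℝ × I) :
    X k w y = ∫⁻ t : ℝ, ∫⁻ s : I, (connectedSet k).indicator 1 (w, y, t, s) := by
  -- The null time `0` is dropped to match the condition `0 < t` in `connectedSet`.
  rw [X, ← setLIntegral_congr Ioi_ae_eq_Ici, ← lintegral_indicator measurableSet_Ioi]
  refine lintegral_congr fun t => ?_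
  by_cases ht : 0 < t
  · have hR := measurable_proj w (measurableSet_remainingTree k w y t)
    rw [indicator_of_mem (mem_Ioi.2 ht), massMeasure, Measure.map_apply (measurable_proj w)
      (measurableSet_remainingTree k w y t), ← lintegral_indicator_one hR]
    refine lintegral_congr fun s => ?_
    by_cases hs : proj w s ∈ remainingTree k w y t
    · rw [indicator_of_mem (show s ∈ proj w ⁻¹' remainingTree k w y t from hs),
        indicator_of_mem (show (w, y, t, s) ∈ connectedSet k from ⟨ht, hs⟩)]
      rfl
    · rw [indicator_of_notMem (show s ∉ proj w ⁻¹' remainingTree k w y t from hs),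
        indicator_of_notMem (show (w, y, t, s) ∉ connectedSet k from fun h => hs h.2)]
  · rw [indicator_of_notMem (by simpa using ht)]
    have hs : ∀ s, (w, y, t, s) ∉ connectedSet k := fun s h => ht h.1
    simp only [indicator_of_notMem (hs _), lintegral_zero]

lemma measurable_indicator_connectedSet (k : ℝ) :
    Measurable ((connectedSet k).indicator (1 : _ × _ × _ × _ → ℝ≥0∞)) :=
  measurable_one.indicator (measurableSet_connectedSet k)

lemma measurable_X (k : ℝ) {α : Type*} [MeasurableSpace α] {w : α → C(I, ℝ)}
    {y : α → ℕ → ℝ × I} (hw : Measurable w) (hy : Measurable y) :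
    Measurable fun a => X k (w a) (y a) := by
  simp only [X_eq_lintegral]
  have h := measurable_indicator_connectedSet k
  refine Measurable.lintegral_prod_right' (f := fun p : α × ℝ =>
    ∫⁻ s : I, (connectedSet k).indicator 1 (w p.1, y p.1, p.2, s)) ?_
  refine Measurable.lintegral_prod_right' (f := fun p : (α × ℝ) × I =>
    (connectedSet k).indicator 1 (w p.1.1, y p.1.1, p.1.2, p.2)) ?_
  exact h.comp ((hw.comp measurable_fst.fst).prodMk ((hy.comp measurable_fst.fst).prodMk
    (measurable_fst.snd.prodMk measurable_snd)))

end Measurability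

end CRT

/-! ### Conditional expectations given a random variable -/

/-- Tested on an event `X ⁻¹' B`, the claim follows by disintegrating the joint law of `(X, Y)` into
the law of `X` and the kernel `condDistrib Y X P`. -/
lemma condLExp_comap_ae_eq_of_lintegral_condDistrib {Ω α β : Type*} [MeasurableSpace Ω]
    [MeasurableSpace α] [MeasurableSpace β] [StandardBorelSpace β] [Nonempty β] {P : Measure Ω}
    [IsFiniteMeasure P] {X : Ω → α} {Y : Ω → β} (hX : Measurable X) (hY : Measurable Y)
    {f : α → β → ℝ≥0∞} {g : α → ℝ≥0∞} (hf : Measurable fun p : α × β => f p.1 p.2)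
    (hg : Measurable g)
    (h : ∀ᵐ a ∂(P.map X), ∫⁻ y, f a y ∂(condDistrib Y X P a) = g a) :
    condLExp (MeasurableSpace.comap X inferInstance) P (fun ω => f (X ω) (Y ω))
      =ᵐ[P] fun ω => g (X ω) := by
  refine (ae_eq_condLExp (hm := hX.comap_le) P _ (hg.comp (comap_measurable X)) ?_).symm
  rintro _ ⟨B, hB, rfl⟩
  have hB' : MeasurableSet (B ×ˢ (univ : Set β)) := hB.prod MeasurableSet.univ
  have h1 : ∫⁻ ω in X ⁻¹' B, f (X ω) (Y ω) ∂P =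
      ∫⁻ p in B ×ˢ univ, f p.1 p.2 ∂(P.map fun ω => (X ω, Y ω)) := by
    rw [setLIntegral_map hB' hf (hX.prodMk hY), mk_preimage_prod, preimage_univ, inter_univ]
  rw [h1, ← compProd_map_condDistrib hY.aemeasurable,
    Measure.setLIntegral_compProd hf hB MeasurableSet.univ]
  simp only [Measure.restrict_univ]
  change ∫⁻ ω in X ⁻¹' B, g (X ω) ∂P = _
  rw [← setLIntegral_map hB hg hX]
  exact setLIntegral_congr_fun_ae hB (h.mono fun a ha _ => ha.symm)

namespace CRT

/-! ### The moments for a fixed coding function -/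

section Moments

/-- The `q`-th moment of `X k` for the tree coded by `w`. -/
noncomputable def moment (k : ℝ) (q : ℕ) (w : C(I, ℝ)) : ℝ≥0∞ :=
  (q ! : ℝ≥0∞) *
    ∫⁻ s : Fin q → I, ∫⁻ x in {x : Fin q → ℝ | (∀ i, 0 < x i) ∧ StrictAnti x},
      ENNReal.ofReal (Real.exp (-(1 / Real.Gamma (k + 1)) * ∑ r, Δ w s r * x r ^ k))

lemma measurable_moment (k : ℝ) (q : ℕ) : Measurable (moment k q) := by
  have h : Measurable fun p : (C(I, ℝ) × (Fin q → I)) × (Fin q → ℝ) => ENNReal.ofReal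
      (Real.exp (-(1 / Real.Gamma (k + 1)) * ∑ r, Δ p.1.1 p.1.2 r * p.2 r ^ k)) := by
    refine ENNReal.measurable_ofReal.comp (Real.measurable_exp.comp
      ((Finset.measurable_sum _ fun r _ => ?_).const_mul _))
    exact ((continuous_Δ r).measurable.comp measurable_fst).mul
      (((measurable_pi_apply r).comp measurable_snd).pow_const k)
  exact (h.lintegral_prod_right' (ν := (volume : Measure (Fin q → ℝ)).restrict
    {x | (∀ i, 0 < x i) ∧ StrictAnti x})).lintegral_prod_right'.const_mul _

lemma X_pow_eq_lintegral (k : ℝ) (w : C(I, ℝ)) (y : ℕ → ℝ × I) (q : ℕ) :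
    X k w y ^ q = ∫⁻ t : Fin q → ℝ, ∫⁻ s : Fin q → I,
      ∏ r, (connectedSet k).indicator 1 (w, y, t r, s r) := by
  have h : Measurable fun p : ℝ × I =>
      (connectedSet k).indicator (1 : _ × _ × _ × _ → ℝ≥0∞) (w, y, p) :=
    (measurable_indicator_connectedSet k).comp
      (measurable_const.prodMk (measurable_const.prodMk measurable_id))
  have h1 := lintegral_fin_nat_prod_eq_prod (n := q) (μ := (volume : Measure ℝ))
    (f := fun _ t => ∫⁻ s : I, (connectedSet k).indicator 1 (w, y, t, s))
    fun _ => h.lintegral_prod_right'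
  rw [Finset.prod_const, Finset.card_univ, Fintype.card_fin, ← X_eq_lintegral] at h1
  rw [← h1]
  refine lintegral_congr fun t => ?_
  exact (lintegral_fin_nat_prod_eq_prod (μ := (volume : Measure I))
    (f := fun r s => (connectedSet k).indicator 1 (w, y, t r, s))
    fun r => h.comp (measurable_const.prodMk measurable_id)).symm

variable {w : C(I, ℝ)}

/-- The product of indicators is the indicator of the joint event. If some `x i ≤ 0`, both sides
vanish. -/
lemma lintegral_prod_indicator_connectedSet (h0 : w 0 = 0) (hw : ∀ s, 0 ≤ w s)
    {Q : Measure (ℕ → ℝ × I)} [IsProbabilityMeasure Q]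
    (hQ : IsPoissonRandomMeasure (cutMeasure w)
      (((volume : Measure ℝ).restrict (Ici 0)).prod (lengthMeasure w)) Q)
    {k : ℝ} (hk : 0 < k) {q : ℕ} {x : Fin q → ℝ} (hx : StrictAnti x) (s : Fin q → I) :
    ∫⁻ y, ∏ r, (connectedSet k).indicator (1 : _ × _ × _ × _ → ℝ≥0∞) (w, y, x r, s r) ∂Q =
      {x : Fin q → ℝ | ∀ i, 0 < x i}.indicator (fun x => ENNReal.ofReal
        (Real.exp (-(1 / Real.Gamma (k + 1)) * ∑ r, Δ w s r * x r ^ k))) x := by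
  by_cases hpos : ∀ i, 0 < x i
  · have hmem : ∀ y r, (w, y, x r, s r) ∈ connectedSet k ↔
        proj w (s r) ∈ remainingTree k w y (x r) := fun y r => and_iff_right (hpos r)
    have hm : MeasurableSet {y | ∀ r, proj w (s r) ∈ remainingTree k w y (x r)} := by
      rw [ofPred_forall]
      exact MeasurableSet.iInter fun r => measurableSet_setOf_proj_mem_remainingTree k
        measurable_const measurable_id measurable_const measurable_const
    rw [indicator_of_mem (by exact hpos : x ∈ {x : Fin q → ℝ | ∀ i, 0 < x i}),
      ← measure_forall_proj_mem_remainingTree h0 hw hQ hk hpos hx s, ← lintegral_indicator_one hm]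
    refine lintegral_congr fun y => ?_
    by_cases hy : ∀ r, proj w (s r) ∈ remainingTree k w y (x r)
    · rw [indicator_of_mem (by exact hy : y ∈ {y | ∀ r, proj w (s r) ∈ remainingTree k w y (x r)})]
      exact Finset.prod_eq_one fun r _ => indicator_of_mem ((hmem y r).2 (hy r)) _
    · rw [indicator_of_notMem (by exact hy : y ∉ {y | ∀ r, proj w (s r) ∈ remainingTree k w y (x r)})]
      push Not at hy
      obtain ⟨r, hr⟩ := hy
      exact Finset.prod_eq_zero (Finset.mem_univ r)
        (indicator_of_notMem (fun h => hr ((hmem y r).1 h)) _)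
  · rw [indicator_of_notMem (by exact hpos : x ∉ {x : Fin q → ℝ | ∀ i, 0 < x i})]
    push Not at hpos
    obtain ⟨r, hr⟩ := hpos
    have : ∀ y, ∏ r, (connectedSet k).indicator (1 : _ × _ × _ × _ → ℝ≥0∞) (w, y, x r, s r) = 0 :=
      fun y => Finset.prod_eq_zero (Finset.mem_univ r)
        (indicator_of_notMem (fun h => absurd h.1 (not_lt.2 hr)) _)
    simp only [this, lintegral_zero]

lemma lintegral_X_pow (h0 : w 0 = 0) (hw : ∀ s, 0 ≤ w s)
    {Q : Measure (ℕ → ℝ × I)} [IsProbabilityMeasure Q]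
    (hQ : IsPoissonRandomMeasure (cutMeasure w)
      (((volume : Measure ℝ).restrict (Ici 0)).prod (lengthMeasure w)) Q)
    {k : ℝ} (hk : 0 < k) (q : ℕ) : ∫⁻ y, X k w y ^ q ∂Q = moment k q w := by
  have hF : Measurable fun p : ((ℕ → ℝ × I) × (Fin q → ℝ)) × (Fin q → I) =>
      ∏ r, (connectedSet k).indicator (1 : _ × _ × _ × _ → ℝ≥0∞)
        (w, p.1.1, p.1.2 r, p.2 r) :=
    Finset.measurable_prod _ fun r _ => (measurable_indicator_connectedSet k).comp
      (measurable_const.prodMk (measurable_fst.fst.prodMk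
        (((measurable_pi_apply r).comp measurable_fst.snd).prodMk
          ((measurable_pi_apply r).comp measurable_snd))))
  set G : (Fin q → ℝ) → (Fin q → I) → ℝ≥0∞ := fun t s =>
    ∫⁻ y, ∏ r, (connectedSet k).indicator (1 : _ × _ × _ × _ → ℝ≥0∞) (w, y, t r, s r) ∂Q with hG
  have hGm : Measurable fun p : (Fin q → ℝ) × (Fin q → I) => G p.1 p.2 :=
    Measurable.lintegral_prod_right' (f := fun p : ((Fin q → ℝ) × (Fin q → I)) × (ℕ → ℝ × I) =>
      ∏ r, (connectedSet k).indicator (1 : _ × _ × _ × _ → ℝ≥0∞) (w, p.2, p.1.1 r, p.1.2 r))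
      (hF.comp ((measurable_snd.prodMk measurable_fst.fst).prodMk measurable_fst.snd))
  have h1 : ∫⁻ y, X k w y ^ q ∂Q = ∫⁻ t : Fin q → ℝ, ∫⁻ s : Fin q → I, G t s := by
    simp only [X_pow_eq_lintegral]
    rw [lintegral_lintegral_swap hF.lintegral_prod_right'.aemeasurable]
    refine lintegral_congr fun t => lintegral_lintegral_swap ?_
    exact (hF.comp ((measurable_fst.prodMk measurable_const).prodMk measurable_snd)).aemeasurable
  -- `G` itself is not symmetric in the times; permuting the integration variable `s` by the same
  -- `e` restores the product.
  have hsymm : ∀ (e : Equiv.Perm (Fin q)) (t : Fin q → ℝ),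
      ∫⁻ s : Fin q → I, G (t ∘ e) s = ∫⁻ s : Fin q → I, G t s := by
    intro e t
    rw [← lintegral_comp_perm e fun s => G (t ∘ e) s]
    refine lintegral_congr fun s => lintegral_congr fun y => ?_
    exact Equiv.prod_comp e fun r => (connectedSet k).indicator 1 (w, y, t r, s r)
  have hpos : MeasurableSet {x : Fin q → ℝ | ∀ i, 0 < x i} := by
    rw [ofPred_forall]
    exact MeasurableSet.iInter fun i => measurableSet_lt measurable_const (measurable_pi_apply i)
  rw [h1, lintegral_eq_factorial_mul_setLIntegral_strictAnti hGm.lintegral_prod_right' hsymm,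
    moment, lintegral_lintegral_swap hGm.aemeasurable]
  congr 1
  refine lintegral_congr fun s => ?_
  rw [setLIntegral_congr_fun (measurableSet_strictAnti q)
    fun x hx => lintegral_prod_indicator_connectedSet h0 hw hQ hk hx s,
    lintegral_indicator hpos, Measure.restrict_restrict hpos]
  rfl

end Moments

/-! ### The Brownian excursion -/

/-- At each interior time the one-dimensional law is carried by the positive half-line. A countable
dense set of times and continuity of the paths give all times at once. -/
lemma IsNormalizedExcursion.ae_nonneg {Ω : Type*} [MeasurableSpace Ω] {ξ : Ω → C(I, ℝ)}
    {P : Measure Ω} (h : IsNormalizedExcursion ξ P) : ∀ᵐ ω ∂P, ∀ s, 0 ≤ ξ ω s := by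
  have key : ∀ s : I, ∀ᵐ ω ∂P, 0 ≤ ξ ω s := by
    intro s
    rcases eq_or_ne s 0 with rfl | hs0
    · filter_upwards [h.zero] with ω hω using hω.ge
    rcases eq_or_ne s 1 with rfl | hs1
    · filter_upwards [h.one] with ω hω using hω.ge
    have h1 := h.map_eq 0 (fun _ => s) (Subsingleton.strictMono (α := Fin 1) _) fun _ =>
      ⟨unitInterval.pos_iff_ne_zero.2 hs0, unitInterval.lt_one_iff_ne_one.2 hs1⟩
    have hm : MeasurableSet {x : Fin (0 + 1) → ℝ | ∀ i, 0 < x i} := by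
      rw [ofPred_forall]
      exact MeasurableSet.iInter fun i => measurableSet_lt measurable_const (measurable_pi_apply i)
    have hξ : Measurable fun ω (_ : Fin (0 + 1)) => ξ ω s :=
      measurable_pi_lambda _ fun _ =>
        (by fun_prop : Continuous fun w : C(I, ℝ) => w s).measurable.comp h.measurable
    have h2 : ∀ᵐ x ∂(P.map fun ω (_ : Fin (0 + 1)) => ξ ω s), ∀ i, 0 < x i := by
      rw [h1]
      exact (withDensity_absolutelyContinuous _ _).ae_le (ae_restrict_mem hm)
    filter_upwards [ae_of_ae_map hξ.aemeasurable h2] with ω hω using (hω 0).le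
  filter_upwards [ae_all_iff.2 fun n => key (TopologicalSpace.denseSeq I n)] with ω hω
  have hcl : IsClosed {s | 0 ≤ ξ ω s} := isClosed_le continuous_const (ξ ω).continuous
  have := hcl.closure_subset_iff.2 (range_subset_iff.2 hω)
  exact fun s => this (TopologicalSpace.denseRange_denseSeq I s)

end CRT

theorem proposition2 {Ω : Type*} [MeasurableSpace Ω] (P : Measure Ω) [IsProbabilityMeasure P]
    (e : Ω → C(I, ℝ)) (he : Measurable e)
    (hexc : CRT.IsNormalizedExcursion (fun ω => (1 / 2 : ℝ) • e ω) P)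
    (Y : Ω → ℕ → ℝ × I) (hY : Measurable Y)
    (hpoisson : ∀ᵐ w ∂(P.map e),
      CRT.IsPoissonRandomMeasure (CRT.cutMeasure w)
        (((volume : Measure ℝ).restrict (Ici 0)).prod (CRT.lengthMeasure w)) (condDistrib Y e P w))
    (k : ℝ) (hk : 1 ≤ k) (q : ℕ) :
    Measurable (fun ω => CRT.X k (e ω) (Y ω)) ∧
    condLExp (MeasurableSpace.comap e inferInstance) P (fun ω => CRT.X k (e ω) (Y ω) ^ q)
      =ᵐ[P] fun ω => (q ! : ℝ≥0∞) *
        ∫⁻ s : Fin q → I, ∫⁻ x in {x : Fin q → ℝ | (∀ i, 0 < x i) ∧ StrictAnti x},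
          ENNReal.ofReal (Real.exp
            (-(1 / Real.Gamma (k + 1)) * ∑ r, CRT.Δ (e ω) s r * x r ^ k)) := by
  refine ⟨CRT.measurable_X k he hY, ?_⟩
  have hgood : ∀ᵐ w ∂(P.map e), w 0 = 0 ∧ ∀ s, 0 ≤ w s := by
    have hcl : IsClosed {w : C(I, ℝ) | w 0 = 0 ∧ ∀ s, 0 ≤ w s} := by
      rw [ofPred_and, ofPred_forall]
      exact (isClosed_eq (by fun_prop) continuous_const).inter
        (isClosed_iInter fun s => isClosed_le continuous_const (by fun_prop))
    rw [ae_map_iff he.aemeasurable hcl.measurableSet]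
    filter_upwards [hexc.zero, hexc.ae_nonneg] with ω h0 hnn
    refine ⟨by simpa using h0, fun s => ?_⟩
    have := hnn s
    simp only [ContinuousMap.smul_apply, smul_eq_mul] at this
    linarith
  exact condLExp_comap_ae_eq_of_lintegral_condDistrib (f := fun w y => CRT.X k w y ^ q) he hY
    ((CRT.measurable_X k measurable_fst measurable_snd).pow_const q)
    (CRT.measurable_moment k q) <| by
    filter_upwards [hgood, hpoisson] with w hw hQ
    exact CRT.lintegral_X_pow hw.1 hw.2 hQ (zero_lt_one.trans_le hk) q
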